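/- Let $\Omega\subset\mathbb C$ be a bounded finitely connected region, fix $z_0\in\Omega$, and let $m$ be the harmonic measure on $\partial\Omega$ for $z_0$. For a complex Banach space $E$, let $H^\infty(\Omega,E)$ be the set of bounded holomorphic functions $\Omega\to E$, and put $H^\infty(\Omega)=H^\infty(\Omega,\mathbb C)$. A function $\theta\in H^\infty(\Omega)$ is *quasi-inner* if there is a constant $c>0$ such that for $m$-almost every $\zeta\in\partial\Omega$ the nontangential boundary value of $\theta$ at $\zeta$ has modulus at least $c$ (if there are several nontangential boundary values at $\zeta$, that is, cluster values of $\theta$ along the approach regions $\{z\in\Omega:|z-\zeta|<a\,\mathrm{dist}(z,\partial\Omega)\}$, $a>1$, this is required of each of them). A function $\theta\in H^\infty(\Omega)$ *divides* $\varphi\in H^\infty(\Omega,E)$ if $\varphi=\theta\psi$ on $\Omega$ for some $\psi\in H^\infty(\Omega,E)$; this is used for $E=\mathbb C$ and for $E=L(\mathbb C^n)$. A *greatest quasi-inner divisor* $D(\varphi)$ of $\varphi\in H^\infty(\Omega,L(\mathbb C^n))$ is a quasi-inner $\theta\in H^\infty(\Omega)$ that divides $\varphi$ and is divisible by every quasi-inner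 function in $H^\infty(\Omega)$ that divides $\varphi$. A *greatest common quasi-inner divisor* $\bigwedge F$ of a family $F\subset H^\infty(\Omega)$ is a quasi-inner $\theta\in H^\infty(\Omega)$ that divides every element of $F$ and is divisible by every quasi-inner function in $H^\infty(\Omega)$ that divides every element of $F$. Both are determined only up to mutual divisibility. **Lemma 3.12.** Let $\varphi=[\varphi_{ij}]_{i,j=1}^n\in H^\infty(\Omega,L(\mathbb C^n))$, where $\varphi_{ij}$ are the entries with respect to the standard basis. Then $D(\varphi)=\bigwedge_{i,j}\varphi_{ij}$. That is, a function $\theta$ on $\Omega$ is a greatest quasi-inner divisor of $\varphi$ if and only if it is a greatest common quasi-inner divisor of $\{\varphi_{ij}:1\le i,j\le n\}$; and any greatest quasi-inner divisor of $\varphi$ and any greatest common quasi-inner divisor of $\{\varphi_{ij}\}$ divide each other. -/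

import Mathlib

open Set Filter Topology MeasureTheory
open scoped ENNReal

/-- A bounded finitely connected region of the plane: a bounded nonempty connected open set whose
complement has finitely many connected components.  (For a bounded set, the components of the
complement in the plane correspond to those of the complement in the Riemann sphere.) -/
structure IsBddFinConnRegion (Ω : Set ℂ) : Prop where
  isOpen : IsOpen Ω
  isConnected : IsConnected Ω
  isBounded : Bornology.IsBounded Ω
  finite_components : Finite (ConnectedComponents (Ωᶜ : Set ℂ))

/-- `f` is in `H^∞(Ω, E)`: it is holomorphic and bounded on `Ω`.  Only the values of `f` on `Ω`
matter.  For `E = ℂ` this is `H^∞(Ω)`, for `E = L(K)` it is `H^∞(Ω, L(K))`. -/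
def IsHInf {E : Type*} [NormedAddCommGroup E] [NormedSpace ℂ E] (Ω : Set ℂ) (f : ℂ → E) : Prop :=
  DifferentiableOn ℂ f Ω ∧ ∃ C : ℝ, ∀ z ∈ Ω, ‖f z‖ ≤ C

/-- Nonnegative superharmonic functions on the open set `Ω` (with value `∞` allowed): lower
semicontinuous functions that are at least their mean over every circle which bounds a closed disc
contained in `Ω`. -/
def IsNonnegSuperharmonicOn (s : ℂ → ℝ≥0∞) (Ω : Set ℂ) : Prop :=
  LowerSemicontinuousOn s Ω ∧
    ∀ (c : ℂ) (r : ℝ), 0 < r → Metric.closedBall c r ⊆ Ω →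
      (∫⁻ t in Ioc 0 (2 * Real.pi), s (circleMap c r t)) / ENNReal.ofReal (2 * Real.pi) ≤ s c

/-- The (outer) harmonic measure at the point `z₀ ∈ Ω` of a set `A` of boundary points of `Ω`: the
upper Perron solution, evaluated at `z₀`, of the Dirichlet problem whose boundary data are
the indicator function of `A`. -/
noncomputable def outerHarmonicMeasure (Ω : Set ℂ) (z₀ : ℂ) (A : Set ℂ) : ℝ≥0∞ :=
  ⨅ (s : ℂ → ℝ≥0∞) (_ : IsNonnegSuperharmonicOn s Ω)
    (_ : ∀ ζ ∈ A, 1 ≤ liminf s (𝓝[Ω] ζ)), s z₀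

/-- `P` holds at almost every boundary point of `Ω`, with respect to harmonic measure for `z₀`. -/
def AEBoundary (Ω : Set ℂ) (z₀ : ℂ) (P : ℂ → Prop) : Prop :=
  outerHarmonicMeasure Ω z₀ {ζ | ζ ∈ frontier Ω ∧ ¬ P ζ} = 0

/-- The nontangential approach region of aperture `a` in `Ω` at the boundary point `ζ`. -/
def approachRegion (Ω : Set ℂ) (a : ℝ) (ζ : ℂ) : Set ℂ :=
  {z | z ∈ Ω ∧ dist z ζ < a * Metric.infDist z (frontier Ω)}

/-- `w` is a nontangential boundary value of `f` at the boundary point `ζ` of `Ω`: a cluster value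
of `f` along a nontangential approach region at `ζ`.  Where `f` has a nontangential limit at `ζ`,
this limit is the only boundary value; at a boundary point that is approached from several sides
(as in a slit disc) the limits from all sides are boundary values. -/
def IsBoundaryValue (Ω : Set ℂ) (f : ℂ → ℂ) (ζ w : ℂ) : Prop :=
  ∃ a : ℝ, MapClusterPt w (𝓝[approachRegion Ω a ζ] ζ) f

/-- `θ ∈ H^∞(Ω)` is quasi-inner: for some constant `c > 0`, `|θ(ζ)| ≥ c` for almost every boundary
point `ζ`, where `θ(ζ)` is the nontangential boundary value. -/
def IsQuasiInner (Ω : Set ℂ) (z₀ : ℂ) (θ : ℂ → ℂ) : Prop :=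
  IsHInf Ω θ ∧
    ∃ c : ℝ, 0 < c ∧ AEBoundary Ω z₀ (fun ζ => ∀ w, IsBoundaryValue Ω θ ζ w → c ≤ ‖w‖)

/-- The scalar function `θ` divides `φ` in `H^∞`: `φ = θ ψ` on `Ω` for some `ψ` in `H^∞(Ω, E)`.
Used for `E = ℂ` (both functions scalar) and for `E = L(K)`. -/
def HInfDvd {E : Type*} [NormedAddCommGroup E] [NormedSpace ℂ E]
    (Ω : Set ℂ) (θ : ℂ → ℂ) (φ : ℂ → E) : Prop :=
  ∃ ψ : ℂ → E, IsHInf Ω ψ ∧ ∀ z ∈ Ω, φ z = θ z • ψ z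

/-- `θ` is a greatest quasi-inner divisor `D(φ)` of the operator-valued function `φ`. -/
def IsGreatestQuasiInnerDivisor {K : Type*} [NormedAddCommGroup K] [InnerProductSpace ℂ K]
    (Ω : Set ℂ) (z₀ : ℂ) (φ : ℂ → (K →L[ℂ] K)) (θ : ℂ → ℂ) : Prop :=
  IsQuasiInner Ω z₀ θ ∧ HInfDvd Ω θ φ ∧
    ∀ η : ℂ → ℂ, IsQuasiInner Ω z₀ η → HInfDvd Ω η φ → HInfDvd Ω η θ

/-- `θ` is a greatest common quasi-inner divisor `⋀ F` of the family `F` of scalar functions. -/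
def IsGreatestCommonQuasiInnerDivisor (Ω : Set ℂ) (z₀ : ℂ) (F : Set (ℂ → ℂ)) (θ : ℂ → ℂ) : Prop :=
  IsQuasiInner Ω z₀ θ ∧ (∀ f ∈ F, HInfDvd Ω θ f) ∧
    ∀ η : ℂ → ℂ, IsQuasiInner Ω z₀ η → (∀ f ∈ F, HInfDvd Ω η f) → HInfDvd Ω η θ

/-- The entry `φ_ij` of an `L(ℂⁿ)`-valued function, with respect to the standard basis. -/
noncomputable def entryFn {n : ℕ}
    (φ : ℂ → (EuclideanSpace ℂ (Fin n) →L[ℂ] EuclideanSpace ℂ (Fin n))) (i j : Fin n) : ℂ → ℂ :=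
  fun z => φ z (EuclideanSpace.single j 1) i

/-! Both notions are a greatest element, under divisibility, among quasi-inner functions dividing
something, so it suffices that `φ` and the family of its entries have the same scalar divisors
(`hInfDvd_iff_forall_entryFn`). Division by a scalar function commutes with bounded linear maps and
finite sums. Each entry is a bounded linear functional of `φ`, and `φ` is the finite sum of its
entries times constant matrix units. Nothing about boundary values enters. -/

/-- The image of an `H^∞` function under a bounded linear map is an `H^∞` function. -/
theorem IsHInf.clm_comp {E F : Type*} [NormedAddCommGroup E] [NormedSpace ℂ E]
    [NormedAddCommGroup F] [NormedSpace ℂ F] {Ω : Set ℂ} {f : ℂ → E} (hf : IsHInf Ω f)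
    (L : E →L[ℂ] F) : IsHInf Ω (fun z => L (f z)) := by
  obtain ⟨hd, C, hC⟩ := hf
  exact ⟨L.differentiable.comp_differentiableOn hd, ‖L‖ * C,
    fun z hz => L.le_opNorm_of_le (hC z hz)⟩

/-- Finite sums of `H^∞` functions are `H^∞` functions. -/
theorem IsHInf.sum {ι E : Type*} [NormedAddCommGroup E] [NormedSpace ℂ E] {Ω : Set ℂ}
    (s : Finset ι) {f : ι → ℂ → E} (hf : ∀ i ∈ s, IsHInf Ω (f i)) :
    IsHInf Ω (fun z => ∑ i ∈ s, f i z) := by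
  refine ⟨DifferentiableOn.fun_sum fun i hi => (hf i hi).1, ?_⟩
  choose! C hC using fun i hi => (hf i hi).2
  exact ⟨∑ i ∈ s, C i, fun z hz => norm_sum_le_of_le s fun i hi => hC i hi z hz⟩

/-- Divisors of a function divide its image under a bounded linear map. -/
theorem HInfDvd.clm_comp {E F : Type*} [NormedAddCommGroup E] [NormedSpace ℂ E]
    [NormedAddCommGroup F] [NormedSpace ℂ F] {Ω : Set ℂ} {θ : ℂ → ℂ} {f : ℂ → E}
    (h : HInfDvd Ω θ f) (L : E →L[ℂ] F) : HInfDvd Ω θ (fun z => L (f z)) := by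
  obtain ⟨ψ, hψ, hf⟩ := h
  exact ⟨fun z => L (ψ z), hψ.clm_comp L, fun z hz => by simp only [hf z hz, map_smul]⟩

/-- A common divisor of finitely many functions divides their sum. -/
theorem HInfDvd.sum {ι E : Type*} [NormedAddCommGroup E] [NormedSpace ℂ E] {Ω : Set ℂ}
    {θ : ℂ → ℂ} (s : Finset ι) {f : ι → ℂ → E} (h : ∀ i ∈ s, HInfDvd Ω θ (f i)) :
    HInfDvd Ω θ (fun z => ∑ i ∈ s, f i z) := by
  choose! ψ hψ hf using h
  refine ⟨fun z => ∑ i ∈ s, ψ i z, IsHInf.sum s hψ, fun z hz => ?_⟩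
  rw [Finset.smul_sum]
  exact Finset.sum_congr rfl fun i hi => hf i hi z hz

/-- The operator with matrix entry `1` at `(i, j)` and `0` elsewhere. -/
noncomputable def matrixUnit {n : ℕ} (i j : Fin n) :
    EuclideanSpace ℂ (Fin n) →L[ℂ] EuclideanSpace ℂ (Fin n) :=
  (EuclideanSpace.proj j : EuclideanSpace ℂ (Fin n) →L[ℂ] ℂ).smulRight (EuclideanSpace.single i 1)

/-- An operator on `ℂⁿ` is the combination of matrix units given by its entries. -/
theorem sum_entryFn_smul_matrixUnit {n : ℕ}
    (φ : ℂ → (EuclideanSpace ℂ (Fin n) →L[ℂ] EuclideanSpace ℂ (Fin n))) (z : ℂ) :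
    ∑ p : Fin n × Fin n, entryFn φ p.1 p.2 z • matrixUnit p.1 p.2 = φ z := by
  rw [Fintype.sum_prod_type]
  refine ContinuousLinearMap.coe_injective
    ((EuclideanSpace.basisFun (Fin n) ℂ).toBasis.ext fun j => ?_)
  ext k
  simp [entryFn, matrixUnit, Pi.single_apply]

/-- A scalar function divides an operator-valued function if and only if it divides all its
entries. -/
theorem hInfDvd_iff_forall_entryFn {n : ℕ} {Ω : Set ℂ} {θ : ℂ → ℂ}
    {φ : ℂ → (EuclideanSpace ℂ (Fin n) →L[ℂ] EuclideanSpace ℂ (Fin n))} :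
    HInfDvd Ω θ φ ↔ ∀ f ∈ {f | ∃ i j : Fin n, f = entryFn φ i j}, HInfDvd Ω θ f := by
  constructor
  · rintro h _ ⟨i, j, rfl⟩
    -- The functional `T ↦ (T e_j)_i`.
    exact h.clm_comp ((EuclideanSpace.proj i : EuclideanSpace ℂ (Fin n) →L[ℂ] ℂ).comp
      (ContinuousLinearMap.apply ℂ _ (EuclideanSpace.single j 1)))
  · intro h
    -- The map `c ↦ c • matrixUnit i j` carries the scalar quotient of each entry to an
    -- operator-valued one; the sum of these is the quotient of `φ`.
    have key := HInfDvd.sum Finset.univ fun (p : Fin n × Fin n) _ =>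
      (h _ ⟨p.1, p.2, rfl⟩).clm_comp
        ((ContinuousLinearMap.id ℂ ℂ).smulRight (matrixUnit p.1 p.2))
    simpa [sum_entryFn_smul_matrixUnit] using key

/-- Once the divisibility conditions are identified, for `θ` and for every competitor `η`, the two
definitions coincide literally. -/
theorem isGreatestQuasiInnerDivisor_iff {n : ℕ} {Ω : Set ℂ} {z₀ : ℂ} {θ : ℂ → ℂ}
    {φ : ℂ → (EuclideanSpace ℂ (Fin n) →L[ℂ] EuclideanSpace ℂ (Fin n))} :
    IsGreatestQuasiInnerDivisor Ω z₀ φ θ ↔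
      IsGreatestCommonQuasiInnerDivisor Ω z₀ {f | ∃ i j : Fin n, f = entryFn φ i j} θ := by
  simp only [IsGreatestQuasiInnerDivisor, IsGreatestCommonQuasiInnerDivisor,
    hInfDvd_iff_forall_entryFn]

theorem lemma3p12 (Ω : Set ℂ) (hΩ : IsBddFinConnRegion Ω) (z₀ : ℂ) (hz₀ : z₀ ∈ Ω) (n : ℕ)
    (φ : ℂ → (EuclideanSpace ℂ (Fin n) →L[ℂ] EuclideanSpace ℂ (Fin n))) (hφ : IsHInf Ω φ) :
    (∀ θ : ℂ → ℂ, IsGreatestQuasiInnerDivisor Ω z₀ φ θ ↔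
      IsGreatestCommonQuasiInnerDivisor Ω z₀ {f | ∃ i j : Fin n, f = entryFn φ i j} θ) ∧
    (∀ θ θ' : ℂ → ℂ, IsGreatestQuasiInnerDivisor Ω z₀ φ θ →
      IsGreatestCommonQuasiInnerDivisor Ω z₀ {f | ∃ i j : Fin n, f = entryFn φ i j} θ' →
      HInfDvd Ω θ θ' ∧ HInfDvd Ω θ' θ) := by
  refine ⟨fun θ => isGreatestQuasiInnerDivisor_iff, fun θ θ' h h' => ?_⟩
  have h₂ := isGreatestQuasiInnerDivisor_iff.1 h
  -- Two greatest elements: each is a competitor in the maximality of the other.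
  exact ⟨h'.2.2 θ h₂.1 h₂.2.1, h₂.2.2 θ' h'.1 h'.2.1⟩
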